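/- Let $X$ be a complex Banach space, $\mathbb{B}=\{z\in X:\|z\|<1\}$, $\mathbb{U}=\{\zeta\in\mathbb{C}:|\zeta|<1\}$, and for $z\in X\setminus\{0\}$ let $T_z$ be the set of continuous linear functionals $l_z:X\to\mathbb{C}$ with $l_z(z)=\|z\|$ and $\|l_z\|=1$. Let $\Phi:\mathbb{U}\to\mathbb{C}$ be biholomorphic onto its image with $\Phi(0)=1$, $\operatorname{Re}\Phi>0$ on $\mathbb{U}$, $\Phi'(0)>0$, $\Phi''(0)\in\mathbb{R}$, and $$2\Phi'(0)-2\Phi'(0)^2\le\Phi''(0)\le 6\Phi'(0)^2-2\Phi'(0).$$ Let $\mathcal{M}_\Phi$ be the class of holomorphic mappings $p:\mathbb{B}\to X$ with $p(0)=0$, $Dp(0)=I$ and $\|z\|/l_z(p(z))\in\Phi(\mathbb{U})$ for all $z\in\mathbb{B}\setminus\{0\}$ and $l_z\in T_z$. Let $g:\mathbb{B}\to\mathbb{C}$ be holomorphic with $g(0)=1$, put $G(z)=g(z)z$, and suppose that $DG(z)$ has a bounded inverse for every $z\in\mathbb{B}$ and that the mapping $z\mapsto (DG(z))^{-1}G(z)$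 belongs to $\mathcal{M}_\Phi$. Then for all $z\in\mathbb{B}\setminus\{0\}$ and $l_z\in T_z$, with $$b_2=\frac{l_z(D^2G(0)(z^2))}{2!\,\|z\|^2},\qquad b_3=\frac{l_z(D^3G(0)(z^3))}{3!\,\|z\|^3},$$ where $D^kG(0)(z^k)$ is the $k$-th Fréchet derivative of $G$ at $0$ evaluated at $(z,\dots,z)$, one has $$|2b_2^2b_3-b_3^2-2b_2^2+1|\le 1+2\Phi'(0)^2+\frac{\Phi'(0)^2}{4}\Big(3\Phi'(0)-\frac{\Phi''(0)}{2\Phi'(0)}\Big)\Big(\frac{\Phi''(0)}{2\Phi'(0)}+\Phi'(0)\Big).$$ The bound is sharp: for every such $\Phi$, every $z\in\mathbb{B}\setminus\{0\}$ and every $l_z\in T_z$ there is a function $g$ satisfying the above hypotheses for which equality holds. -/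

import Mathlib

/-- `f` is biholomorphic on `Ω`: it is holomorphic on `Ω` (locally the sum of its Taylor series),
`f(Ω)` is a domain, and `f` has an inverse that is holomorphic on `f(Ω)`. -/
structure IsBiholomorphicOn (f : ℂ → ℂ) (Ω : Set ℂ) : Prop where
  analytic : AnalyticOnNhd ℂ f Ω
  isOpen_image : IsOpen (f '' Ω)
  isConnected_image : IsConnected (f '' Ω)
  exists_inverse : ∃ ψ : ℂ → ℂ, AnalyticOnNhd ℂ ψ (f '' Ω) ∧ ∀ ζ ∈ Ω, ψ (f ζ) = ζ

/-- The functions `Φ` on the unit disk: biholomorphic, `Φ(0) = 1`, `Re Φ > 0`, `Φ'(0)` real and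
positive, `Φ''(0)` real. -/
structure IsAdmissible (Φ : ℂ → ℂ) : Prop where
  biholomorphic : IsBiholomorphicOn Φ (Metric.ball (0 : ℂ) 1)
  map_zero : Φ 0 = 1
  re_pos : ∀ ζ ∈ Metric.ball (0 : ℂ) 1, 0 < (Φ ζ).re
  deriv_im : (deriv Φ 0).im = 0
  deriv_re_pos : 0 < (deriv Φ 0).re
  deriv_two_im : (iteratedDeriv 2 Φ 0).im = 0

section
variable {X : Type*} [NormedAddCommGroup X] [NormedSpace ℂ X]

/-- `T_z`: the continuous linear functionals `l` with `l(z) = ‖z‖` and `‖l‖ = 1`. -/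
def normingFunctionals (z : X) : Set (X →L[ℂ] ℂ) :=
  {l | l z = (‖z‖ : ℂ) ∧ ‖l‖ = 1}

/-- The class `M_Φ` of holomorphic `p : 𝔹 → X` on the open unit ball with `p(0) = 0`,
`Dp(0) = I` and `‖z‖ / l_z(p(z)) ∈ Φ(𝕌)` for all `z ∈ 𝔹 \ {0}` and `l_z ∈ T_z`. -/
def classM (X : Type*) [NormedAddCommGroup X] [NormedSpace ℂ X] (Φ : ℂ → ℂ) : Set (X → X) :=
  {p | AnalyticOnNhd ℂ p (Metric.ball (0 : X) 1) ∧ p 0 = 0 ∧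
    fderiv ℂ p 0 = ContinuousLinearMap.id ℂ X ∧
    ∀ z ∈ Metric.ball (0 : X) 1, z ≠ 0 → ∀ l ∈ normingFunctionals z,
      l (p z) ≠ 0 ∧ (‖z‖ : ℂ) / l (p z) ∈ Φ '' Metric.ball (0 : ℂ) 1}

/-- The mapping `G(z) = z g(z)`. -/
def mulSelfMap (g : X → ℂ) : X → X := fun z => g z • z

/-- `g` is a holomorphic function on the unit ball with `g(0) = 1` such that, for `G(z) = z g(z)`,
`DG(z)` has a bounded inverse at every point of the ball and `(DG(z))⁻¹ G(z)` lies in `M_Φ`. -/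
structure IsInClass (Φ : ℂ → ℂ) (g : X → ℂ) : Prop where
  analytic : AnalyticOnNhd ℂ g (Metric.ball (0 : X) 1)
  map_zero : g 0 = 1
  invertible : ∀ z ∈ Metric.ball (0 : X) 1, (fderiv ℂ (mulSelfMap g) z).IsInvertible
  mem_classM : (fun z => (fderiv ℂ (mulSelfMap g) z).inverse (mulSelfMap g z)) ∈ classM X Φ

/-- `l(D^k G(0)(z^k)) / (k! ‖z‖^k)`. -/
noncomputable def normalizedCoeff (G : X → X) (k : ℕ) (z : X) (l : X →L[ℂ] ℂ) : ℂ :=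
  l (iteratedFDeriv ℂ k G 0 (fun _ => z)) / ((k.factorial : ℂ) * (‖z‖ : ℂ) ^ k)

/-- `2 b₂² b₃ - b₃² - 2 b₂² + 1` for the normalized coefficients `b₂, b₃` of `G(z) = z g(z)`. -/
noncomputable def toeplitzValue (g : X → ℂ) (z : X) (l : X →L[ℂ] ℂ) : ℂ :=
  2 * normalizedCoeff (mulSelfMap g) 2 z l ^ 2 * normalizedCoeff (mulSelfMap g) 3 z l
    - normalizedCoeff (mulSelfMap g) 3 z l ^ 2 - 2 * normalizedCoeff (mulSelfMap g) 2 z l ^ 2 + 1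

end

/-- `1 + 2A² + (A²/4)(3A - B/(2A))(B/(2A) + A)`, with `A = Φ'(0)` and `B = Φ''(0)`. -/
noncomputable def toeplitzBound (A B : ℝ) : ℝ :=
  1 + 2 * A ^ 2 + A ^ 2 / 4 * (3 * A - B / (2 * A)) * (B / (2 * A) + A)

/-!
Since `DG(x)h = g(x) h + Dg(x)(h) x`, the vector `DG(x)⁻¹ G(x)` is the multiple
`g(x) / (g(x) + Dg(x)(x))` of `x`, so membership in the class says that `1 + Dg(x)(x) / g(x)` takes
its values in `Φ(𝕌)` (`IsInClass.exists_eq_mul`, with the converse `isInClass_of_eq_mul`). On the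
slice `f(ζ) = g(ζ z / ‖z‖)` this reads `f + ζ f' = f · (Φ ∘ ω)` for the Schwarz function
`ω = Φ⁻¹ ∘ (1 + ζ f' / f)` (`IsInClass.exists_schwarz`), and `b₂ = f'(0)`, `b₃ = f''(0) / 2`.

Write `A = Φ'(0)`, `B = Φ''(0)`, `D = B / (2A)` and `ω(ζ) = c₁ ζ + c₂ ζ² + ⋯`. Comparing coefficients
gives `b₂ = A c₁`, `b₃ = (A / 2) (c₂ + (D + A) c₁²)` and
`b₃ - 2 b₂² = (A / 2) (c₂ - (3A - D) c₁²)`. The determinant is `1 - 2 b₂² - b₃ (b₃ - 2 b₂²)`. The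
hypotheses on `B` say exactly that `D + A ≥ 1` and `3A - D ≥ 1`, so the Fekete–Szegő inequality
`norm_add_mul_sq_le`, a consequence of `|c₂| ≤ 1 - |c₁|²` (`norm_coeff_two_le_of_schwarz`), bounds
both factors of the product, and the triangle inequality finishes.

For `ω(ζ) = iζ` all these inequalities are equalities and the three terms are positive. The
corresponding `f` is the exponential of a primitive of `(Φ(iζ) - 1) / ζ` (`exists_extremal_slice`),
and `g(x) = f(l(x))` is extremal for the given `z` and `l`.
-/

/-! ### Second derivatives and coefficient comparison -/

/-- The second derivative of a product of two analytic functions. -/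
theorem deriv_deriv_mul_of_analyticAt {u v : ℂ → ℂ} {x : ℂ} (hu : AnalyticAt ℂ u x)
    (hv : AnalyticAt ℂ v x) :
    deriv (deriv fun ζ => u ζ * v ζ) x =
      deriv (deriv u) x * v x + 2 * (deriv u x * deriv v x) + u x * deriv (deriv v) x := by
  have h : deriv (fun ζ => u ζ * v ζ) =ᶠ[nhds x] fun ζ => deriv u ζ * v ζ + u ζ * deriv v ζ := by
    filter_upwards [hu.eventually_analyticAt, hv.eventually_analyticAt] with ζ h1 h2
    exact deriv_fun_mul h1.differentiableAt h2.differentiableAt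
  rw [h.deriv_eq, deriv_fun_add (hu.deriv.fun_mul hv).differentiableAt
      (hu.fun_mul hv.deriv).differentiableAt,
    deriv_fun_mul hu.deriv.differentiableAt hv.differentiableAt,
    deriv_fun_mul hu.differentiableAt hv.deriv.differentiableAt]
  ring

/-- The second derivative of a composition of two analytic functions. -/
theorem deriv_deriv_comp_of_analyticAt {u v : ℂ → ℂ} {x : ℂ} (hu : AnalyticAt ℂ u (v x))
    (hv : AnalyticAt ℂ v x) :
    deriv (deriv fun ζ => u (v ζ)) x =
      deriv (deriv u) (v x) * deriv v x ^ 2 + deriv u (v x) * deriv (deriv v) x := by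
  have h : deriv (fun ζ => u (v ζ)) =ᶠ[nhds x] fun ζ => deriv u (v ζ) * deriv v ζ := by
    filter_upwards [hv.continuousAt.eventually hu.eventually_analyticAt,
      hv.eventually_analyticAt] with ζ h1 h2
    exact deriv_comp ζ h1.differentiableAt h2.differentiableAt
  have h' : deriv (fun ζ => deriv u (v ζ)) x = deriv (deriv u) (v x) * deriv v x :=
    deriv_comp x hu.deriv.differentiableAt hv.differentiableAt
  rw [h.deriv_eq, deriv_fun_mul (hu.deriv.fun_comp hv).differentiableAt hv.deriv.differentiableAt, h']
  ring

theorem deriv_deriv_id_mul {u : ℂ → ℂ} (hu : AnalyticAt ℂ u 0) :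
    deriv (deriv fun ζ => ζ * u ζ) 0 = 2 * deriv u 0 := by
  have hid : AnalyticAt ℂ (fun ζ : ℂ => ζ) 0 := analyticAt_id
  rw [deriv_deriv_mul_of_analyticAt hid hu, deriv_id'']
  simp

theorem deriv_deriv_add_id_mul_deriv {f : ℂ → ℂ} (hf : AnalyticAt ℂ f 0) :
    deriv (deriv fun ζ => f ζ + ζ * deriv f ζ) 0 = 3 * deriv (deriv f) 0 := by
  have hid : AnalyticAt ℂ (fun ζ : ℂ => ζ) 0 := analyticAt_id
  have h : deriv (fun ζ => f ζ + ζ * deriv f ζ) =ᶠ[nhds 0]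
      fun ζ => deriv f ζ + deriv (fun ζ => ζ * deriv f ζ) ζ := by
    filter_upwards [hf.eventually_analyticAt] with ζ h1
    exact deriv_fun_add h1.differentiableAt (differentiableAt_id.fun_mul h1.deriv.differentiableAt)
  rw [h.deriv_eq, deriv_fun_add hf.deriv.differentiableAt
    (hid.fun_mul hf.deriv).deriv.differentiableAt, deriv_deriv_id_mul hf.deriv]
  ring

/-- The coefficients of the solution of `f + ζ f' = f · (Φ ∘ ω)`. -/
theorem deriv_of_subordination {Φ f ω : ℂ → ℂ} (hΦ : AnalyticAt ℂ Φ 0) (hΦ0 : Φ 0 = 1)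
    (hf : AnalyticAt ℂ f 0) (hf0 : f 0 = 1) (hω : AnalyticAt ℂ ω 0) (hω0 : ω 0 = 0)
    (h : (fun ζ => f ζ + ζ * deriv f ζ) =ᶠ[nhds 0] fun ζ => f ζ * Φ (ω ζ)) :
    deriv f 0 = deriv Φ 0 * deriv ω 0 ∧
      2 * deriv (deriv f) 0 = 2 * (deriv Φ 0 * deriv ω 0) ^ 2 +
        deriv (deriv Φ) 0 * deriv ω 0 ^ 2 + deriv Φ 0 * deriv (deriv ω) 0 := by
  have hΦ' : AnalyticAt ℂ Φ (ω 0) := by rwa [hω0]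
  have hu : AnalyticAt ℂ (fun ζ => Φ (ω ζ)) 0 := hΦ'.comp hω
  have hid : AnalyticAt ℂ (fun ζ : ℂ => ζ) 0 := analyticAt_id
  have hu1 : deriv (fun ζ => Φ (ω ζ)) 0 = deriv Φ 0 * deriv ω 0 := by
    have := deriv_comp (0 : ℂ) hΦ'.differentiableAt hω.differentiableAt
    rwa [hω0] at this
  have hu2 := deriv_deriv_comp_of_analyticAt hΦ' hω
  have e1 := h.deriv_eq
  have e2 := h.deriv.deriv_eq
  rw [deriv_fun_add hf.differentiableAt (hid.fun_mul hf.deriv).differentiableAt,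
    deriv_fun_mul hid.differentiableAt hf.deriv.differentiableAt,
    deriv_fun_mul hf.differentiableAt hu.differentiableAt, hu1, hω0, hΦ0, hf0] at e1
  rw [deriv_deriv_add_id_mul_deriv hf, deriv_deriv_mul_of_analyticAt hf hu, hu1, hu2, hω0, hΦ0,
    hf0] at e2
  have e3 : deriv f 0 = deriv Φ 0 * deriv ω 0 := by
    simp only [deriv_id'', zero_mul] at e1
    linear_combination e1
  refine ⟨e3, ?_⟩
  rw [e3] at e2
  linear_combination e2

/-! ### Coefficients of Schwarz functions -/

/-- **Schwarz–Pick at the origin**, for maps into the open disk. -/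
theorem norm_deriv_le_one_sub_sq_of_mapsTo_ball {h : ℂ → ℂ}
    (hd : DifferentiableOn ℂ h (Metric.ball 0 1))
    (hm : Set.MapsTo h (Metric.ball 0 1) (Metric.ball 0 1)) :
    ‖deriv h 0‖ ≤ 1 - ‖h 0‖ ^ 2 := by
  have h0 : (0 : ℂ) ∈ Metric.ball (0 : ℂ) 1 := by simp
  set a := h 0 with ha
  have ha1 : ‖a‖ < 1 := by simpa using hm h0
  have hden : ∀ w : ℂ, ‖w‖ < 1 → 1 - (starRingEnd ℂ) a * w ≠ 0 := by
    intro w hw e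
    have : ‖(starRingEnd ℂ) a * w‖ = 1 := by rw [← sub_eq_zero.mp e]; simp
    rw [norm_mul, RCLike.norm_conj] at this
    nlinarith [norm_nonneg a, norm_nonneg w]
  have hlt : ∀ w : ℂ, ‖w‖ < 1 → ‖w - a‖ ≤ ‖1 - (starRingEnd ℂ) a * w‖ := by
    intro w hw
    rw [← abs_of_nonneg (norm_nonneg (w - a)), ← abs_of_nonneg (norm_nonneg (1 - _)),
      ← sq_le_sq, ← Complex.normSq_eq_norm_sq, ← Complex.normSq_eq_norm_sq]
    have h1 : Complex.normSq a < 1 := by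
      rw [Complex.normSq_eq_norm_sq]; nlinarith [norm_nonneg a]
    have h2 : Complex.normSq w < 1 := by
      rw [Complex.normSq_eq_norm_sq]; nlinarith [norm_nonneg w]
    have : Complex.normSq (1 - (starRingEnd ℂ) a * w) - Complex.normSq (w - a) =
        (1 - Complex.normSq a) * (1 - Complex.normSq w) := by
      simp [Complex.normSq_apply]; ring
    nlinarith
  -- The Schwarz lemma is applied to `h` followed by the disk automorphism that sends `a` to `0`.
  have hdiff : DifferentiableOn ℂ (fun ζ => (h ζ - a) / (1 - (starRingEnd ℂ) a * h ζ))
      (Metric.ball 0 1) :=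
    (hd.sub_const a).div ((hd.const_mul _).const_sub 1) fun ζ hζ => hden _ (by simpa using hm hζ)
  have hh := hd.differentiableAt (Metric.isOpen_ball.mem_nhds h0)
  have hder : deriv (fun ζ => (h ζ - a) / (1 - (starRingEnd ℂ) a * h ζ)) 0 =
      deriv h 0 / (1 - (starRingEnd ℂ) a * a) := by
    have := ((hh.hasDerivAt.sub_const a).div ((hh.hasDerivAt.const_mul
      ((starRingEnd ℂ) a)).const_sub 1) (hden _ ha1)).deriv
    refine Eq.trans this ?_
    have h3 := hden a ha1
    rw [← ha]
    field_simp
    ring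
  have key := Complex.norm_deriv_le_one_of_mapsTo_ball hdiff (fun ζ hζ => ?_) one_pos
  · have h4 : 1 - (starRingEnd ℂ) a * a = ((1 - ‖a‖ ^ 2 : ℝ) : ℂ) := by
      rw [mul_comm, Complex.mul_conj, Complex.normSq_eq_norm_sq]; push_cast; ring
    have h5 : 0 < 1 - ‖a‖ ^ 2 := by nlinarith [norm_nonneg a]
    rw [hder, h4, norm_div, Complex.norm_real, Real.norm_of_nonneg h5.le, div_le_one h5] at key
    exact key
  · have hζ' : ‖h ζ‖ < 1 := by simpa using hm hζ
    simp only [← ha, sub_self, zero_div, mem_closedBall_zero_iff, norm_div]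
    exact div_le_one_of_le₀ (hlt _ hζ') (norm_nonneg _)

/-- The bounds `|c₁| ≤ 1` and `|c₂| ≤ 1 - |c₁|²` for the Taylor coefficients
`c₁ = ω'(0)`, `c₂ = ω''(0) / 2` of a Schwarz function `ω`. -/
theorem norm_coeff_two_le_of_schwarz {ω : ℂ → ℂ} (hd : DifferentiableOn ℂ ω (Metric.ball 0 1))
    (hm : Set.MapsTo ω (Metric.ball 0 1) (Metric.ball 0 1)) (h0 : ω 0 = 0) :
    ‖deriv ω 0‖ ≤ 1 ∧ ‖deriv (deriv ω) 0 / 2‖ ≤ 1 - ‖deriv ω 0‖ ^ 2 := by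
  have h0m : Metric.ball (0 : ℂ) 1 ∈ nhds (0 : ℂ) := Metric.ball_mem_nhds _ one_pos
  have hm' : Set.MapsTo ω (Metric.ball 0 1) (Metric.closedBall (ω 0) 1) := by
    rw [h0]; exact hm.mono_right Metric.ball_subset_closedBall
  set k := dslope ω 0 with hk
  have hkd : DifferentiableOn ℂ k (Metric.ball 0 1) :=
    (Complex.differentiableOn_dslope h0m).2 hd
  have hka : AnalyticAt ℂ k 0 := hkd.analyticAt h0m
  have hk0 : k 0 = deriv ω 0 := dslope_same _ _
  have hk1 : ∀ ζ ∈ Metric.ball (0 : ℂ) 1, ‖k ζ‖ ≤ 1 := fun ζ hζ => by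
    simpa using Complex.norm_dslope_le_div_of_mapsTo_ball hd hm' hζ
  have hωk : ω = fun ζ => ζ * k ζ := by
    funext ζ
    have := sub_smul_dslope ω 0 ζ
    simp only [sub_zero, h0, smul_eq_mul] at this
    exact this.symm
  have hω2 : deriv (deriv ω) 0 / 2 = deriv k 0 := by
    conv_lhs => rw [hωk]
    rw [deriv_deriv_id_mul hka]; ring
  refine ⟨by rw [← hk0]; exact hk1 0 (by simp), ?_⟩
  rw [hω2, ← hk0]
  -- `r k` maps into the open disk for `0 ≤ r < 1`; let `r → 1`.
  have hr : ∀ r ∈ Set.Ioo (0 : ℝ) 1, r * ‖deriv k 0‖ ≤ 1 - (r * ‖k 0‖) ^ 2 := by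
    intro r hr
    have := norm_deriv_le_one_sub_sq_of_mapsTo_ball (h := fun ζ => (r : ℂ) * k ζ)
      (hkd.const_mul _) (fun ζ hζ => by
        rw [mem_ball_zero_iff, norm_mul, Complex.norm_real, Real.norm_of_nonneg hr.1.le]
        nlinarith [hk1 ζ hζ, hr.1, hr.2, norm_nonneg (k ζ)])
    rwa [deriv_const_mul _ hka.differentiableAt, norm_mul, norm_mul, Complex.norm_real,
      Real.norm_of_nonneg hr.1.le] at this
  have hne : (nhdsWithin (1 : ℝ) (Set.Ioo 0 1)).NeBot := by
    rw [← mem_closure_iff_nhdsWithin_neBot, closure_Ioo zero_ne_one]; simp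
  have hl : Filter.Tendsto (fun r : ℝ => r * ‖deriv k 0‖) (nhdsWithin 1 (Set.Ioo 0 1))
      (nhds (1 * ‖deriv k 0‖)) := (Continuous.tendsto (by fun_prop) _).mono_left nhdsWithin_le_nhds
  have hl' : Filter.Tendsto (fun r : ℝ => 1 - (r * ‖k 0‖) ^ 2) (nhdsWithin 1 (Set.Ioo 0 1))
      (nhds (1 - (1 * ‖k 0‖) ^ 2)) :=
    (Continuous.tendsto (by fun_prop) _).mono_left nhdsWithin_le_nhds
  have := le_of_tendsto_of_tendsto hl hl' (Filter.mem_of_superset self_mem_nhdsWithin hr)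
  simpa using this

/-- The **Fekete–Szegő inequality** for Schwarz functions. -/
theorem norm_add_mul_sq_le {c₁ c₂ : ℂ} (h₁ : ‖c₁‖ ≤ 1) (h₂ : ‖c₂‖ ≤ 1 - ‖c₁‖ ^ 2) {t : ℝ}
    (ht : 1 ≤ |t|) : ‖c₂ + t * c₁ ^ 2‖ ≤ |t| := by
  calc ‖c₂ + t * c₁ ^ 2‖ ≤ ‖c₂‖ + |t| * ‖c₁‖ ^ 2 := by
        refine (norm_add_le _ _).trans_eq ?_
        rw [norm_mul, norm_pow, Complex.norm_real, Real.norm_eq_abs]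
    _ ≤ |t| := by nlinarith [mul_nonneg (sub_nonneg.2 ht) (sub_nonneg.2 (pow_le_one₀ (n := 2)
        (norm_nonneg c₁) h₁))]

/-! ### Slices of `G(z) = g(z) z` -/

/-- The value at `z` of the derivative of `G(z) = g(z) z`. -/
theorem fderiv_mulSelfMap_apply {X : Type*} [NormedAddCommGroup X] [NormedSpace ℂ X] {g : X → ℂ}
    {z : X} (hg : DifferentiableAt ℂ g z) (h : X) :
    fderiv ℂ (mulSelfMap g) z h = g z • h + fderiv ℂ g z h • z := by
  have : HasFDerivAt (mulSelfMap g) _ z := hg.hasFDerivAt.smul (hasFDerivAt_id z)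
  rw [this.fderiv]
  simp

/-- A slice `ζ ↦ g (ζ z₀)` determines the normalized coefficients of `G(z) = g(z) z`. -/
theorem normalizedCoeff_mulSelfMap {X : Type*} [NormedAddCommGroup X] [NormedSpace ℂ X] [CompleteSpace X]
    {g : X → ℂ} (hg : AnalyticOnNhd ℂ g (Metric.ball 0 1)) {z : X} (hz : z ≠ 0) {l : X →L[ℂ] ℂ}
    (hl : l ∈ normingFunctionals z) (k : ℕ) :
    normalizedCoeff (mulSelfMap g) k z l =
      iteratedDeriv k (fun ζ : ℂ => ζ * g (ζ • ((‖z‖ : ℂ)⁻¹ • z))) 0 / k.factorial := by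
  have hz' : (‖z‖ : ℂ) ≠ 0 := by simpa using hz
  set z₀ : X := (‖z‖ : ℂ)⁻¹ • z with hz₀
  have hzz : z = (‖z‖ : ℂ) • z₀ := by rw [hz₀, smul_inv_smul₀ hz']
  have hz₀n : ‖z₀‖ = 1 := norm_smul_inv_norm (𝕜 := ℂ) hz
  have hlz₀ : l z₀ = 1 := by
    rw [hz₀, map_smul, hl.1, smul_eq_mul, inv_mul_cancel₀ hz']
  have hG : AnalyticOnNhd ℂ (mulSelfMap g) (Metric.ball 0 1) := hg.smul analyticOnNhd_id
  have h0 : (0 : X) ∈ Metric.ball (0 : X) 1 := by simp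
  have h0' : (0 : ℂ) ∈ Metric.ball (0 : ℂ) 1 := by simp
  let L : ℂ →L[ℂ] X := (ContinuousLinearMap.id ℂ ℂ).smulRight z₀
  have hpre : L ⁻¹' Metric.ball 0 1 = Metric.ball 0 1 := by
    ext ζ; simp [L, norm_smul, hz₀n]
  have hop : IsOpen (Metric.ball (0 : X) 1) := Metric.isOpen_ball
  have hop' : IsOpen (Metric.ball (0 : ℂ) 1) := Metric.isOpen_ball
  have hlG : AnalyticOnNhd ℂ (fun x => l (mulSelfMap g x)) (Metric.ball 0 1) :=
    fun x hx => l.analyticAt _ |>.comp (hG x hx)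
  have e1 : iteratedFDeriv ℂ k (fun x => l (mulSelfMap g x)) 0 =
      l.compContinuousMultilinearMap (iteratedFDeriv ℂ k (mulSelfMap g) 0) :=
    l.iteratedFDeriv_comp_left (hG 0 h0).contDiffAt le_rfl
  have e2 := L.iteratedFDerivWithin_comp_right (f := fun x => l (mulSelfMap g x))
    (n := k) (s := Metric.ball 0 1) (hlG.contDiffOn hop.uniqueDiffOn) hop.uniqueDiffOn
    (by rw [hpre]; exact hop'.uniqueDiffOn) (x := 0) (by simp) (i := k) le_rfl
  rw [hpre, iteratedFDerivWithin_of_isOpen k hop' h0', map_zero,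
    iteratedFDerivWithin_of_isOpen k hop h0, e1] at e2
  have e3 : (fun x => l (mulSelfMap g x)) ∘ L = fun ζ : ℂ => ζ * g (ζ • z₀) := by
    funext ζ
    simp [L, mulSelfMap, hlz₀, mul_comm]
  rw [e3] at e2
  have e4 : l (iteratedFDeriv ℂ k (mulSelfMap g) 0 fun _ => z₀) =
      iteratedDeriv k (fun ζ : ℂ => ζ * g (ζ • z₀)) 0 := by
    rw [iteratedDeriv_eq_iteratedFDeriv, e2]
    simp [L]
  have e5 : (iteratedFDeriv ℂ k (mulSelfMap g) 0 fun _ => z) =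
      (‖z‖ : ℂ) ^ k • iteratedFDeriv ℂ k (mulSelfMap g) 0 fun _ => z₀ := by
    conv_lhs => rw [hzz]
    rw [ContinuousMultilinearMap.map_smul_univ]
    simp
  rw [normalizedCoeff, e5, map_smul, e4, smul_eq_mul]
  field_simp

/-- The Toeplitz determinant in terms of the slice `f(ζ) = g (ζ z₀)`: here `b₂ = f'(0)` and
`b₃ = f''(0) / 2`. -/
theorem toeplitzValue_eq {X : Type*} [NormedAddCommGroup X] [NormedSpace ℂ X] [CompleteSpace X]
    {g : X → ℂ} (hg : AnalyticOnNhd ℂ g (Metric.ball 0 1)) {z : X} (hz : z ≠ 0) {l : X →L[ℂ] ℂ}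
    (hl : l ∈ normingFunctionals z) {f : ℂ → ℂ}
    (hf : f = fun ζ : ℂ => g (ζ • ((‖z‖ : ℂ)⁻¹ • z))) :
    toeplitzValue g z l = 1 - 2 * deriv f 0 ^ 2 -
      deriv (deriv f) 0 / 2 * (deriv (deriv f) 0 / 2 - 2 * deriv f 0 ^ 2) := by
  have hfa : AnalyticAt ℂ f 0 := by
    rw [hf]
    refine AnalyticAt.fun_comp ?_ (by fun_prop)
    simpa using hg 0 (by simp)
  have e : ∀ k, normalizedCoeff (mulSelfMap g) k z l =
      iteratedDeriv k (fun ζ : ℂ => ζ * f ζ) 0 / k.factorial := by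
    intro k; rw [normalizedCoeff_mulSelfMap hg hz hl, hf]
  have e2 : iteratedDeriv 2 (fun ζ : ℂ => ζ * f ζ) 0 = 2 * deriv f 0 := by
    rw [iteratedDeriv_succ, iteratedDeriv_one, deriv_deriv_id_mul hfa]
  have e3 : iteratedDeriv 3 (fun ζ : ℂ => ζ * f ζ) 0 = 3 * deriv (deriv f) 0 := by
    have h : deriv (fun ζ => ζ * f ζ) =ᶠ[nhds 0] fun ζ => f ζ + ζ * deriv f ζ := by
      filter_upwards [hfa.eventually_analyticAt] with ζ h1
      rw [deriv_fun_mul differentiableAt_fun_id h1.differentiableAt, deriv_id'', one_mul]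
    rw [iteratedDeriv_succ, iteratedDeriv_succ, iteratedDeriv_one, h.deriv.deriv_eq,
      deriv_deriv_add_id_mul_deriv hfa]
  rw [toeplitzValue, e, e, e2, e3]
  norm_num [Nat.factorial]
  ring

/-! ### Membership in the class -/

section
variable {X : Type*} [NormedAddCommGroup X] [NormedSpace ℂ X]

/-- For `g` in the class, `1 + Dg(x)(x) / g(x)` takes its values in `Φ(𝕌)`. -/
theorem IsInClass.exists_eq_mul {Φ : ℂ → ℂ} (hΦ0 : Φ 0 = 1) {g : X → ℂ} (hg : IsInClass Φ g)
    {x : X} (hx : x ∈ Metric.ball (0 : X) 1) :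
    g x ≠ 0 ∧ ∃ w ∈ Metric.ball (0 : ℂ) 1, g x + fderiv ℂ g x x = g x * Φ w := by
  by_cases hx0 : x = 0
  · subst hx0
    rw [hg.map_zero]
    exact ⟨one_ne_zero, 0, by simp, by simp [hΦ0]⟩
  obtain ⟨l, hl1, hlx⟩ := exists_dual_vector ℂ x (norm_ne_zero_iff.2 hx0)
  have hl : l ∈ normingFunctionals x := ⟨hlx, hl1⟩
  obtain ⟨hp0, w, hw, hwΦ⟩ := hg.mem_classM.2.2.2 x hx hx0 l hl
  have hinv := hg.invertible x hx
  have hDx : fderiv ℂ (mulSelfMap g) x x = (g x + fderiv ℂ g x x) • x := by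
    rw [fderiv_mulSelfMap_apply (hg.analytic x hx).differentiableAt, add_smul]
  have hc : g x + fderiv ℂ g x x ≠ 0 := by
    intro h
    rw [h, zero_smul] at hDx
    exact hx0 (hinv.bijective.1 (hDx.trans (_root_.map_zero (fderiv ℂ (mulSelfMap g) x)).symm))
  have hp : (fderiv ℂ (mulSelfMap g) x).inverse (mulSelfMap g x) =
      (g x / (g x + fderiv ℂ g x x)) • x := by
    rw [hinv.inverse_apply_eq, map_smul, hDx, smul_smul, div_mul_cancel₀ _ hc, mulSelfMap]
  have hn : (‖x‖ : ℂ) ≠ 0 := by simpa using hx0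
  simp only [hp, map_smul, smul_eq_mul] at hp0 hwΦ
  have hg0 : g x ≠ 0 := by
    intro h; simp [h] at hp0
  refine ⟨hg0, w, hw, ?_⟩
  rw [hwΦ, hl.1]
  field_simp

/-- A sufficient condition for membership in the class, through the identity
`g(x) + Dg(x)(x) = g(x) Φ(ω(x))`. -/
theorem isInClass_of_eq_mul {Φ : ℂ → ℂ} (hΦ : IsAdmissible Φ) {g ω : X → ℂ}
    (hg : AnalyticOnNhd ℂ g (Metric.ball 0 1)) (hg0 : g 0 = 1)
    (hne : ∀ x ∈ Metric.ball (0 : X) 1, g x ≠ 0)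
    (hω : AnalyticOnNhd ℂ ω (Metric.ball 0 1))
    (hm : Set.MapsTo ω (Metric.ball 0 1) (Metric.ball 0 1)) (hω0 : ω 0 = 0)
    (h : ∀ x ∈ Metric.ball (0 : X) 1, g x + fderiv ℂ g x x = g x * Φ (ω x)) :
    IsInClass Φ g := by
  have hΦne : ∀ x ∈ Metric.ball (0 : X) 1, Φ (ω x) ≠ 0 := fun x hx e => by
    have := hΦ.re_pos _ (hm hx)
    simp [e] at this
  have hinv : ∀ x ∈ Metric.ball (0 : X) 1, (fderiv ℂ (mulSelfMap g) x).IsInvertible := by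
    intro x hx
    have h1 := hne x hx
    have h2 := hΦne x hx
    have hd := (hg x hx).differentiableAt
    have h3 : fderiv ℂ g x x = g x * Φ (ω x) - g x := by rw [← h x hx]; ring
    refine ContinuousLinearMap.IsInvertible.of_inverse
      (g := (g x)⁻¹ • ContinuousLinearMap.id ℂ X -
        ((g x ^ 2 * Φ (ω x))⁻¹ • fderiv ℂ g x).smulRight x) ?_ ?_
    · ext y
      simp only [ContinuousLinearMap.comp_apply, sub_apply, smul_apply,
        ContinuousLinearMap.smulRight_apply,
        ContinuousLinearMap.id_apply, fderiv_mulSelfMap_apply hd, map_sub, map_smul, h3,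
        smul_eq_mul]
      match_scalars
      · field_simp
      · field_simp
        ring
    · ext y
      simp only [ContinuousLinearMap.comp_apply, sub_apply, smul_apply,
        ContinuousLinearMap.smulRight_apply,
        ContinuousLinearMap.id_apply, fderiv_mulSelfMap_apply hd, map_add, map_smul, h3,
        smul_eq_mul]
      match_scalars
      · field_simp
      · field_simp
        ring
  have hp : ∀ x ∈ Metric.ball (0 : X) 1,
      (fderiv ℂ (mulSelfMap g) x).inverse (mulSelfMap g x) = (Φ (ω x))⁻¹ • x := by
    intro x hx
    have h2 := hΦne x hx
    rw [(hinv x hx).inverse_apply_eq, map_smul,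
      fderiv_mulSelfMap_apply (hg x hx).differentiableAt, ← add_smul, h x hx, smul_smul, mulSelfMap,
      mul_comm (g x), inv_mul_cancel_left₀ h2]
  have hΦω : AnalyticOnNhd ℂ (fun x => (Φ (ω x))⁻¹) (Metric.ball 0 1) := fun x hx =>
    ((hΦ.biholomorphic.analytic _ (hm hx)).fun_comp (hω x hx)).fun_inv (hΦne x hx)
  have hop : IsOpen (Metric.ball (0 : X) 1) := Metric.isOpen_ball
  have h0 : (0 : X) ∈ Metric.ball (0 : X) 1 := by simp
  refine ⟨hg, hg0, hinv, ?_, ?_, ?_, ?_⟩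
  · exact (hΦω.smul analyticOnNhd_id).congr hop fun x hx => (hp x hx).symm
  · exact (hp 0 h0).trans (smul_zero _)
  · have he : (fun z => (fderiv ℂ (mulSelfMap g) z).inverse (mulSelfMap g z)) =ᶠ[nhds 0]
        mulSelfMap fun x => (Φ (ω x))⁻¹ := by
      filter_upwards [hop.mem_nhds h0] with x hx
      exact hp x hx
    rw [he.fderiv_eq]
    ext y
    rw [fderiv_mulSelfMap_apply (hΦω 0 h0).differentiableAt]
    simp [hω0, hΦ.map_zero]
  · intro z hz hz0 l hl
    have hn : (‖z‖ : ℂ) ≠ 0 := by simpa using hz0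
    have h2 := hΦne z hz
    simp only [hp z hz, map_smul, hl.1, smul_eq_mul]
    refine ⟨mul_ne_zero (inv_ne_zero h2) hn, ω z, hm hz, ?_⟩
    field_simp

end

/-! ### The coefficient estimate -/

/-- The Toeplitz determinant of a slice in terms of the coefficients `c₁, c₂` of the Schwarz
function `ω`. -/
theorem toeplitz_eq_of_coeff {A B : ℝ} (hA : 0 < A) {d₁ d₂ c₁ w₂ : ℂ} (h₁ : d₁ = A * c₁)
    (h₂ : 2 * d₂ = 2 * (A * c₁) ^ 2 + B * c₁ ^ 2 + A * w₂) :
    1 - 2 * d₁ ^ 2 - d₂ / 2 * (d₂ / 2 - 2 * d₁ ^ 2) =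
      1 - 2 * A ^ 2 * c₁ ^ 2 - A ^ 2 / 4 * ((w₂ / 2 + (B / (2 * A) + A : ℝ) * c₁ ^ 2) *
        (w₂ / 2 + (-(3 * A - B / (2 * A)) : ℝ) * c₁ ^ 2)) := by
  have hA' : (A : ℂ) ≠ 0 := by exact_mod_cast hA.ne'
  have h₂' : d₂ = (2 * (A * c₁) ^ 2 + B * c₁ ^ 2 + A * w₂) / 2 := by rw [← h₂]; ring
  subst h₁ h₂'
  push_cast
  field_simp
  ring

/-- The triangle inequality together with the Fekete–Szegő inequality for the parameters
`B / (2A) + A` and `-(3A - B / (2A))`, both of modulus at least one. -/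
theorem norm_toeplitz_le {A B : ℝ} (hA : 0 < A) (hlow : 1 ≤ B / (2 * A) + A)
    (hupp : 1 ≤ 3 * A - B / (2 * A)) {c₁ c₂ : ℂ} (h₁ : ‖c₁‖ ≤ 1) (h₂ : ‖c₂‖ ≤ 1 - ‖c₁‖ ^ 2) :
    ‖1 - 2 * A ^ 2 * c₁ ^ 2 - A ^ 2 / 4 * ((c₂ + (B / (2 * A) + A : ℝ) * c₁ ^ 2) *
        (c₂ + (-(3 * A - B / (2 * A)) : ℝ) * c₁ ^ 2))‖ ≤ toeplitzBound A B := by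
  set s := B / (2 * A) + A with hs
  set t := 3 * A - B / (2 * A) with ht
  have k1 := norm_add_mul_sq_le h₁ h₂ (t := s) (by rwa [abs_of_nonneg (by linarith)])
  have k2 := norm_add_mul_sq_le h₁ h₂ (t := -t) (by rwa [abs_neg, abs_of_nonneg (by linarith)])
  rw [abs_of_nonneg (by linarith)] at k1
  rw [abs_neg, abs_of_nonneg (by linarith)] at k2
  have e1 : ‖(2 * A ^ 2 * c₁ ^ 2 : ℂ)‖ ≤ 2 * A ^ 2 := by
    rw [norm_mul, norm_mul, norm_pow, norm_pow, Complex.norm_real, Real.norm_of_nonneg hA.le]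
    have : ‖c₁‖ ^ 2 ≤ 1 := pow_le_one₀ (norm_nonneg _) h₁
    norm_num
    nlinarith [sq_nonneg A]
  have e2 : ‖(A ^ 2 / 4 * ((c₂ + s * c₁ ^ 2) * (c₂ + (-t : ℝ) * c₁ ^ 2)) : ℂ)‖ ≤
      A ^ 2 / 4 * (s * t) := by
    rw [norm_mul, norm_mul, norm_div, norm_pow, Complex.norm_real, Real.norm_of_nonneg hA.le]
    norm_num only [Complex.norm_ofNat]
    gcongr
  calc _ ≤ 1 + 2 * A ^ 2 + A ^ 2 / 4 * (s * t) := by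
        refine (norm_sub_le _ _).trans (add_le_add ((norm_sub_le _ _).trans ?_) e2)
        simpa using e1
    _ = toeplitzBound A B := by rw [toeplitzBound, ← hs, ← ht]; ring

section
variable {X : Type*} [NormedAddCommGroup X] [NormedSpace ℂ X]

/-! ### Reduction to the disk and the extremal slice -/

/-- Along a slice, a member of the class satisfies `f + ζ f' = f · (Φ ∘ ω)` with a Schwarz
function `ω`. -/
theorem IsInClass.exists_schwarz {Φ : ℂ → ℂ} (hΦ : IsAdmissible Φ) {g : X → ℂ}
    (hg : IsInClass Φ g) {z₀ : X} (hz₀ : ‖z₀‖ = 1) {f : ℂ → ℂ} (hf : f = fun ζ : ℂ => g (ζ • z₀)) :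
    ∃ ω : ℂ → ℂ, DifferentiableOn ℂ ω (Metric.ball 0 1) ∧
      Set.MapsTo ω (Metric.ball 0 1) (Metric.ball 0 1) ∧ ω 0 = 0 ∧
      ∀ ζ ∈ Metric.ball (0 : ℂ) 1, f ζ + ζ * deriv f ζ = f ζ * Φ (ω ζ) := by
  obtain ⟨ψ, hψ, hψΦ⟩ := hΦ.biholomorphic.exists_inverse
  have hmem : ∀ ζ ∈ Metric.ball (0 : ℂ) 1, ζ • z₀ ∈ Metric.ball (0 : X) 1 := fun ζ hζ => by
    simpa [norm_smul, hz₀] using hζ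
  have hfa : AnalyticOnNhd ℂ f (Metric.ball 0 1) := by
    intro ζ hζ
    rw [hf]
    exact (hg.analytic _ (hmem ζ hζ)).fun_comp (f := fun ζ : ℂ => ζ • z₀) (by fun_prop)
  have hfd : ∀ ζ ∈ Metric.ball (0 : ℂ) 1, ζ * deriv f ζ = fderiv ℂ g (ζ • z₀) (ζ • z₀) := by
    intro ζ hζ
    have h1 := (hg.analytic _ (hmem ζ hζ)).differentiableAt.hasFDerivAt.comp_hasDerivAt ζ
      ((hasDerivAt_id ζ).smul_const z₀)
    have h2 : deriv f ζ = fderiv ℂ g (ζ • z₀) z₀ := by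
      rw [hf]; exact h1.deriv.trans (by simp)
    rw [h2, map_smul, smul_eq_mul]
  have hw : ∀ ζ ∈ Metric.ball (0 : ℂ) 1, f ζ ≠ 0 ∧ ∃ w ∈ Metric.ball (0 : ℂ) 1,
      f ζ + ζ * deriv f ζ = f ζ * Φ w := by
    intro ζ hζ
    rw [hfd ζ hζ, hf]
    exact hg.exists_eq_mul hΦ.map_zero (hmem ζ hζ)
  have hq : ∀ ζ ∈ Metric.ball (0 : ℂ) 1, ∃ w ∈ Metric.ball (0 : ℂ) 1,
      (f ζ + ζ * deriv f ζ) / f ζ = Φ w := by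
    intro ζ hζ
    obtain ⟨h0, w, hw, e⟩ := hw ζ hζ
    exact ⟨w, hw, by rw [e, mul_div_cancel_left₀ _ h0]⟩
  refine ⟨fun ζ => ψ ((f ζ + ζ * deriv f ζ) / f ζ), ?_, ?_, ?_, ?_⟩
  · intro ζ hζ
    obtain ⟨w, hwm, e⟩ := hq ζ hζ
    refine (AnalyticAt.fun_comp (f := fun ζ => (f ζ + ζ * deriv f ζ) / f ζ)
      (hψ _ ⟨w, hwm, e.symm⟩) ?_).differentiableAt.differentiableWithinAt
    exact ((hfa ζ hζ).fun_add (analyticAt_id.fun_mul (hfa ζ hζ).deriv)).fun_div (hfa ζ hζ)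
      (hw ζ hζ).1
  · intro ζ hζ
    obtain ⟨w, hwm, e⟩ := hq ζ hζ
    simp only [e, hψΦ w hwm, hwm]
  · have hf0 : f 0 = 1 := by simp [hf, hg.map_zero]
    have := hψΦ 0 (by simp)
    rw [hΦ.map_zero] at this
    simpa [hf0] using this
  · intro ζ hζ
    obtain ⟨w, hwm, e⟩ := hq ζ hζ
    simp only [e, hψΦ w hwm]
    rw [← e, mul_div_cancel₀ _ (hw ζ hζ).1]

end

/-- The solution `f` of `f + ζ f' = f Φ(iζ)`, `f(0) = 1`, in the unit disk. -/
theorem exists_extremal_slice {Φ : ℂ → ℂ} (hΦ : AnalyticOnNhd ℂ Φ (Metric.ball 0 1))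
    (hΦ0 : Φ 0 = 1) :
    ∃ f : ℂ → ℂ, AnalyticOnNhd ℂ f (Metric.ball 0 1) ∧ f 0 = 1 ∧ (∀ ζ, f ζ ≠ 0) ∧
      ∀ ζ ∈ Metric.ball (0 : ℂ) 1, f ζ + ζ * deriv f ζ = f ζ * Φ (Complex.I * ζ) := by
  have hI : ∀ ζ ∈ Metric.ball (0 : ℂ) 1, Complex.I * ζ ∈ Metric.ball (0 : ℂ) 1 := fun ζ hζ => by
    simpa using hζ
  have hd : DifferentiableOn ℂ (fun ζ => Φ (Complex.I * ζ)) (Metric.ball 0 1) := fun ζ hζ =>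
    ((hΦ _ (hI ζ hζ)).fun_comp (f := fun ζ => Complex.I * ζ)
      (by fun_prop)).differentiableAt.differentiableWithinAt
  obtain ⟨F, hF0, hF⟩ := ((Complex.differentiableOn_dslope
    (Metric.ball_mem_nhds (0 : ℂ) one_pos)).2 hd).isExactOn_ball.with_val_at 0 0
  have hE : ∀ ζ ∈ Metric.ball (0 : ℂ) 1, HasDerivAt (fun ζ => Complex.exp (F ζ))
      (Complex.exp (F ζ) * dslope (fun ζ => Φ (Complex.I * ζ)) 0 ζ) ζ := fun ζ hζ => (hF ζ hζ).cexp
  refine ⟨fun ζ => Complex.exp (F ζ), ?_, by simp [hF0], fun ζ => Complex.exp_ne_zero _, ?_⟩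
  · exact DifferentiableOn.analyticOnNhd
      (fun ζ hζ => (hE ζ hζ).differentiableAt.differentiableWithinAt) Metric.isOpen_ball
  · intro ζ hζ
    have := sub_smul_dslope (fun ζ => Φ (Complex.I * ζ)) 0 ζ
    simp only [sub_zero, mul_zero, hΦ0, smul_eq_mul] at this
    rw [(hE ζ hζ).deriv]
    linear_combination Complex.exp (F ζ) * this

theorem theorem4 {X : Type*} [NormedAddCommGroup X] [NormedSpace ℂ X] [CompleteSpace X]
    (Φ : ℂ → ℂ) (hΦ : IsAdmissible Φ)
    (hlow : 2 * (deriv Φ 0).re - 2 * (deriv Φ 0).re ^ 2 ≤ (iteratedDeriv 2 Φ 0).re)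
    (hupp : (iteratedDeriv 2 Φ 0).re ≤ 6 * (deriv Φ 0).re ^ 2 - 2 * (deriv Φ 0).re) :
    (∀ g : X → ℂ, IsInClass Φ g →
      ∀ z ∈ Metric.ball (0 : X) 1, z ≠ 0 → ∀ l ∈ normingFunctionals z,
        ‖toeplitzValue g z l‖ ≤ toeplitzBound (deriv Φ 0).re (iteratedDeriv 2 Φ 0).re) ∧
    (∀ z ∈ Metric.ball (0 : X) 1, z ≠ 0 → ∀ l ∈ normingFunctionals z,
      ∃ g : X → ℂ, IsInClass Φ g ∧
        ‖toeplitzValue g z l‖ = toeplitzBound (deriv Φ 0).re (iteratedDeriv 2 Φ 0).re) := by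
  have hA := hΦ.deriv_re_pos
  have hA' : deriv Φ 0 = ((deriv Φ 0).re : ℂ) := Complex.ext rfl (by simp [hΦ.deriv_im])
  have hB' : deriv (deriv Φ) 0 = ((iteratedDeriv 2 Φ 0).re : ℂ) := by
    rw [← iteratedDeriv_one (f := Φ), ← iteratedDeriv_succ]
    exact Complex.ext rfl (by simp [hΦ.deriv_two_im])
  have hΦ0 : AnalyticAt ℂ Φ 0 := hΦ.biholomorphic.analytic 0 (by simp)
  set A := (deriv Φ 0).re
  set B := (iteratedDeriv 2 Φ 0).re
  have hlow' : 1 ≤ B / (2 * A) + A := by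
    have : 1 - A ≤ B / (2 * A) := by rw [le_div_iff₀ (by positivity)]; linarith
    linarith
  have hupp' : 1 ≤ 3 * A - B / (2 * A) := by
    have : B / (2 * A) ≤ 3 * A - 1 := by rw [div_le_iff₀ (by positivity)]; linarith
    linarith
  have hball : Metric.ball (0 : ℂ) 1 ∈ nhds (0 : ℂ) := Metric.ball_mem_nhds _ one_pos
  constructor
  · intro g hg z _ hz0 l hl
    obtain ⟨f, hf⟩ : ∃ f : ℂ → ℂ, f = fun ζ : ℂ => g (ζ • ((‖z‖ : ℂ)⁻¹ • z)) := ⟨_, rfl⟩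
    have hfa : AnalyticAt ℂ f 0 := by
      rw [hf]
      refine AnalyticAt.fun_comp ?_ (by fun_prop)
      simpa using hg.analytic 0 (by simp)
    obtain ⟨ω, hω, hm, hω0, h⟩ := hg.exists_schwarz hΦ (norm_smul_inv_norm (𝕜 := ℂ) hz0) hf
    obtain ⟨k1, k2⟩ := norm_coeff_two_le_of_schwarz hω hm hω0
    obtain ⟨h1, h2⟩ := deriv_of_subordination hΦ0 hΦ.map_zero hfa (by simp [hf, hg.map_zero])
      (hω.analyticAt hball) hω0 (Filter.mem_of_superset hball h)
    rw [hA'] at h1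
    rw [hA', hB'] at h2
    rw [toeplitzValue_eq hg.analytic hz0 hl hf, toeplitz_eq_of_coeff hA h1 h2]
    exact norm_toeplitz_le hA hlow' hupp' k1 k2
  · intro z _ hz0 l hl
    obtain ⟨f, hfa, hf0, hfne, h⟩ := exists_extremal_slice hΦ.biholomorphic.analytic hΦ.map_zero
    have hlm : ∀ x ∈ Metric.ball (0 : X) 1, l x ∈ Metric.ball (0 : ℂ) 1 := fun x hx => by
      rw [mem_ball_zero_iff] at hx ⊢
      exact (l.le_opNorm x).trans_lt (by rwa [hl.2, one_mul])
    have hg : AnalyticOnNhd ℂ (fun x => f (l x)) (Metric.ball 0 1) := fun x hx =>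
      (hfa _ (hlm x hx)).fun_comp (l.analyticAt x)
    refine ⟨fun x => f (l x), isInClass_of_eq_mul (ω := fun x => Complex.I * l x) hΦ hg
      (by simp [hf0]) (fun x _ => hfne _) (fun x _ => analyticAt_const.fun_mul (l.analyticAt x))
      (fun x hx => by simpa using hlm x hx) (by simp) fun x hx => ?_, ?_⟩
    · have := ((hfa _ (hlm x hx)).differentiableAt.hasDerivAt.comp_hasFDerivAt x
        l.hasFDerivAt).fderiv
      have e : fderiv ℂ (fun x => f (l x)) x x = l x * deriv f (l x) := by
        refine (congrArg (fun L : X →L[ℂ] ℂ => L x) this).trans ?_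
        simp [mul_comm]
      rw [e]
      exact h _ (hlm x hx)
    · have hs : f = fun ζ : ℂ => f (l (ζ • ((‖z‖ : ℂ)⁻¹ • z))) := by
        have hn : (‖z‖ : ℂ) ≠ 0 := by simpa using hz0
        funext ζ
        simp [hl.1, hn]
      have hω1 : deriv (fun ζ : ℂ => Complex.I * ζ) = fun _ => Complex.I := by
        funext ζ; simp
      obtain ⟨h1, h2⟩ := deriv_of_subordination (ω := fun ζ => Complex.I * ζ) hΦ0 hΦ.map_zero
        (hfa 0 (by simp)) hf0 (by fun_prop) (by simp) (Filter.mem_of_superset hball h)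
      rw [hA'] at h1
      rw [hA', hB'] at h2
      rw [toeplitzValue_eq hg hz0 hl hs, toeplitz_eq_of_coeff hA h1 h2]
      -- Here `c₁ = i` and `c₂ = 0`, so that all three terms are positive.
      have e : (1 - 2 * A ^ 2 * deriv (fun ζ : ℂ => Complex.I * ζ) 0 ^ 2 - A ^ 2 / 4 *
          ((deriv (deriv fun ζ : ℂ => Complex.I * ζ) 0 / 2 +
            (B / (2 * A) + A : ℝ) * deriv (fun ζ : ℂ => Complex.I * ζ) 0 ^ 2) *
          (deriv (deriv fun ζ : ℂ => Complex.I * ζ) 0 / 2 +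
            (-(3 * A - B / (2 * A)) : ℝ) * deriv (fun ζ : ℂ => Complex.I * ζ) 0 ^ 2)) : ℂ) =
          (toeplitzBound A B : ℂ) := by
        rw [hω1, toeplitzBound]
        simp only [Complex.I_sq, deriv_const]
        push_cast
        ring
      rw [e, Complex.norm_real, Real.norm_of_nonneg]
      rw [toeplitzBound]
      have := mul_nonneg (mul_nonneg (by positivity : 0 ≤ A ^ 2 / 4)
        (zero_le_one.trans hupp')) (zero_le_one.trans hlow')
      positivity
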